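/- **Theorem 3.1 (Optimality of EXP-A-CSMA).** *Model.* Let $V$ be a finite set of queues (links), let $G=(V,E)$ be a simple interference graph, and let $\mathcal I(G)=\{\rho\in\{0,1\}^V:\rho_i+\rho_j\le 1 \text{ for all } (i,j)\in E\}$ be the set of feasible schedules. Let $\mathcal H\subset(0,1]$ be a finite set with $1\in\mathcal H$. Let $\gamma=[\gamma^{u\to v}]$, with $\gamma^{u\to v}\ge 0$ for $u\ne v$ in $\mathcal H^V$, be the transition rates of an irreducible continuous-time Markov process on $\mathcal H^V$ (the channel), and let $[\pi_c]_{c\in\mathcal H^V}$ be its stationary distribution. The capacity region $\boldsymbol C(\gamma,G)$ is the set of vectors $\sum_{c}\pi_c\sum_{\rho\in\mathcal I(G)}\alpha_{\rho,c}\,[c_i\rho_i]_{i\in V}$ with $\alpha_{\rho,c}\ge 0$ and $\sum_{\rho}\alpha_{\rho,c}=1$ for all $c$. A vector $\lambda\in\mathbb R_{\ge 0}^V$ is strictly admissible, $\lambda\in\boldsymbol\Lambda^o(\gamma,G)$, if there is $\lambda'\in\boldsymbol C(\gamma,G)$ with $\lambda_i<\lambda'_i$ for all $i$. *Algorithm.*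 Given functions $f_i,g_i:[0,1]\to(0,\infty)$, $i\in V$, the A-CSMA algorithm makes the pair $(\sigma(t),c(t))$ of schedule and channel state a continuous-time Markov process on $\mathcal I(G)\times\mathcal H^V$ (with right-continuous paths and any initial law) with the following transition rates: $(\sigma,u)\to(\sigma,v)$ at rate $\gamma^{u\to v}$; from $(\sigma,c)$ with $\sigma_i=0$, the coordinate $\sigma_i$ becomes $1$ at rate $f_i(c_i)\prod_{j:(i,j)\in E}(1-\sigma_j)$; from $(\sigma,c)$ with $\sigma_i=1$, the coordinate $\sigma_i$ becomes $0$ at rate $g_i(c_i)$. It is an EXP-A-CSMA algorithm with constants $[r_i]\in\mathbb R^V$ if $$\log\frac{f_i(x)}{g_i(x)}=r_i\,x\qquad\text{for all } x\in[0,1],\ i\in V.$$ *Queues.* Work arrives at queue $i$ according to a non-decreasing cumulative process $A_i(0,t)<\infty$ with $\lim_{t\to\infty}A_i(0,t)/t=\lambda_i$ almost surely (as holds for a stationary ergodic arrival process of rate $\lambda_i$); put $A_i(s,t)=A_i(0,t)-A_i(0,s)$. The queue contents satisfy $Q_i(t)\ge 0$, $Q_i(0)=0$ and $Q_i(t)=Q_i(s)-\int_s^t\sigma_i(r)c_i(r)\mathbf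 1_{\{Q_i(r)>0\}}\,dr+A_i(s,t)$ for $0\le s<t$. The cumulative departures are $D_i(t)=\int_0^t\sigma_i(r)c_i(r)\mathbf 1_{\{Q_i(r)>0\}}\,dr$. The algorithm is rate-stable for $\lambda$ if $\lim_{t\to\infty}D_i(t)/t=\lambda_i$ for all $i\in V$ with probability $1$, for all such arrival processes with rates $\lambda$. *Theorem.* For every $G$, $\mathcal H$, $\gamma$ as above and every $\lambda\in\boldsymbol\Lambda^o(\gamma,G)$ there are constants $[r_i]$ and positive functions $[f_i]$, $[g_i]$ on $[0,1]$ with $\log(f_i(x)/g_i(x))=r_i x$ for all $x\in[0,1]$ and $i\in V$ such that the corresponding EXP-A-CSMA algorithm is rate-stable for $\lambda$. -/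

import Mathlib

open scoped Topology
open MeasureTheory Filter

universe w

/-- The generator matrix of a continuous-time Markov chain on a finite set `S` with transition
rates `q x y`, `x ≠ y`: off the diagonal it is `q`, and every row sums to zero.
The diagonal values of `q` are ignored. -/
def generator {S : Type*} [Fintype S] [DecidableEq S] (q : S → S → ℝ) : Matrix S S ℝ :=
  Matrix.of fun x y => if x = y then -∑ z ∈ Finset.univ.erase x, q x z else q x y

/-- Transition rates: non-negative off the diagonal. -/
def IsRates {S : Type*} (q : S → S → ℝ) : Prop :=
  ∀ x y, x ≠ y → 0 ≤ q x y

/-- Irreducibility: every state can be reached from every other one through transitions of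
positive rate. -/
def IsIrreducibleRates {S : Type*} (q : S → S → ℝ) : Prop :=
  ∀ x y, Relation.ReflTransGen (fun a b => a ≠ b ∧ 0 < q a b) x y

/-- `p` is a stationary distribution of the chain with rates `q` (global balance). -/
def IsStationaryLaw {S : Type*} [Fintype S] [DecidableEq S] (q : S → S → ℝ) (p : S → ℝ) :
    Prop :=
  (∀ x, 0 ≤ p x) ∧ ∑ x, p x = 1 ∧ ∀ y, ∑ x, p x * generator q x y = 0

/-- `X` is a continuous-time, time-homogeneous Markov process with transition rates `q` on the
finite set `S`, with an arbitrary initial law and right-continuous paths. Its finite-dimensional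
laws are given by the transition semigroup `exp (t • generator q)`. -/
structure IsMarkovJumpProcess {Ω : Type*} [MeasurableSpace Ω] (P : Measure Ω)
    {S : Type*} [Fintype S] [DecidableEq S] (q : S → S → ℝ) (X : ℝ → Ω → S) : Prop where
  measurable : ∀ t, 0 ≤ t → ∀ x, MeasurableSet {ω | X t ω = x}
  right_cts : ∀ᵐ ω ∂P, ∀ t, 0 ≤ t → ∀ᶠ s in 𝓝[>] t, X s ω = X t ω
  law : ∀ (k : ℕ) (t : ℕ → ℝ), t 0 = 0 → Monotone t → ∀ x : ℕ → S,
    P.real {ω | ∀ j ≤ k, X (t j) ω = x j} =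
      P.real {ω | X 0 ω = x 0} *
        ∏ j ∈ Finset.range k,
          (NormedSpace.exp ((t (j + 1) - t j) • generator q) : Matrix S S ℝ) (x j) (x (j + 1))

section Model

variable {V : Type*} [Fintype V] [DecidableEq V]

/-- The set of feasible schedules: vectors `ρ` in `{0,1}^V` with `ρ i + ρ j ≤ 1` for every edge. -/
abbrev Schedule (G : SimpleGraph V) : Type _ :=
  {ρ : V → Fin 2 // ∀ i j, G.Adj i j → (ρ i : ℕ) + (ρ j : ℕ) ≤ 1}

/-- The coordinate `ρ i` as a real number, `0` or `1`. -/
def Schedule.bit {G : SimpleGraph V} (ρ : Schedule G) (i : V) : ℝ := ((ρ.1 i : ℕ) : ℝ)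

/-- The channel states: vectors of capacities in `H`. -/
abbrev ChannelState (V : Type*) (H : Finset ℝ) : Type _ := V → H

/-- The finite set of channel capacities of a link: contained in `(0, 1]`, with maximum `1`. -/
def IsCapacitySet (H : Finset ℝ) : Prop :=
  (∀ h ∈ H, 0 < h ∧ h ≤ 1) ∧ (1 : ℝ) ∈ H

variable {H : Finset ℝ}

/-- The capacity region: averages over the stationary channel law `p` of channel-dependent
convex combinations of the service vectors `[c i * ρ i]`. -/
def capacityRegion (γ : ChannelState V H → ChannelState V H → ℝ)
    (G : SimpleGraph V) [DecidableRel G.Adj] : Set (V → ℝ) :=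
  {x | ∃ p : ChannelState V H → ℝ, IsStationaryLaw γ p ∧
    ∃ α : ChannelState V H → Schedule G → ℝ,
      (∀ c ρ, 0 ≤ α c ρ) ∧ (∀ c, ∑ ρ, α c ρ = 1) ∧
      ∀ i, x i = ∑ c, p c * ∑ ρ, α c ρ * ((c i : ℝ) * Schedule.bit ρ i)}

/-- The strictly admissible arrival rates: non-negative vectors that are, in every component,
strictly below some point of the capacity region. -/
def strictlyAdmissible (γ : ChannelState V H → ChannelState V H → ℝ)
    (G : SimpleGraph V) [DecidableRel G.Adj] : Set (V → ℝ) :=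
  {l | (∀ i, 0 ≤ l i) ∧ ∃ l' ∈ capacityRegion γ G, ∀ i, l i < l' i}

/-- The transition rates of the process (schedule, channel) under A-CSMA: the channel moves with
rates `γ`, an idle link `i` without transmitting neighbours starts to transmit at rate
`f i (c i)`, and a transmitting link `i` stops at rate `g i (c i)`. -/
noncomputable def acsmaRate (γ : ChannelState V H → ChannelState V H → ℝ)
    (G : SimpleGraph V) [DecidableRel G.Adj] (f g : V → ℝ → ℝ)
    (x y : Schedule G × ChannelState V H) : ℝ :=
  if x.1 = y.1 then γ x.2 y.2
  else if x.2 = y.2 then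
    ∑ i, (if x.1.1 i = 0 ∧ y.1.1 = Function.update x.1.1 i 1 then
            f i (x.2 i) * ∏ j ∈ G.neighborFinset i, (1 - Schedule.bit x.1 j)
          else if x.1.1 i = 1 ∧ y.1.1 = Function.update x.1.1 i 0 then g i (x.2 i)
          else 0)
  else 0

section Queues

variable {Ω : Type*} {G : SimpleGraph V}

/-- The potential service rate `σ i * c i` of queue `i` at time `t`. -/
noncomputable def serviceRate (X : ℝ → Ω → Schedule G × ChannelState V H) (i : V) (t : ℝ)
    (ω : Ω) : ℝ :=
  Schedule.bit (X t ω).1 i * ((X t ω).2 i : ℝ)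

/-- The cumulative work that leaves queue `i` during `(s, t]`. -/
noncomputable def departures (X : ℝ → Ω → Schedule G × ChannelState V H) (Q : V → ℝ → Ω → ℝ)
    (i : V) (s t : ℝ) (ω : Ω) : ℝ :=
  ∫ r in s..t, serviceRate X i r ω * (if 0 < Q i r ω then 1 else 0)

variable [MeasurableSpace Ω]

/-- Cumulative arrival processes, `A i t` being the work that arrives at queue `i` during `(0, t]`,
with long-run rates `l i`. -/
structure IsArrivalProcess (P : Measure Ω) (l : V → ℝ) (A : V → ℝ → Ω → ℝ) : Prop where
  measurable : ∀ i t, 0 ≤ t → Measurable (A i t)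
  zero : ∀ᵐ ω ∂P, ∀ i, A i 0 ω = 0
  mono : ∀ᵐ ω ∂P, ∀ i, MonotoneOn (fun t => A i t ω) (Set.Ici 0)
  rate : ∀ᵐ ω ∂P, ∀ i, Tendsto (fun t => A i t ω / t) atTop (𝓝 (l i))

/-- `Q` is the vector of queue contents: it starts empty, is non-negative, and follows the
queueing dynamics driven by the arrivals `A` and the (schedule, channel) process `X`. -/
structure IsQueueProcess (P : Measure Ω) (X : ℝ → Ω → Schedule G × ChannelState V H)
    (A Q : V → ℝ → Ω → ℝ) : Prop where
  path_measurable : ∀ᵐ ω ∂P, ∀ i, Measurable fun t : NNReal => Q i t ω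
  nonneg : ∀ᵐ ω ∂P, ∀ i t, 0 ≤ t → 0 ≤ Q i t ω
  start : ∀ᵐ ω ∂P, ∀ i, Q i 0 ω = 0
  dynamics : ∀ᵐ ω ∂P, ∀ i s t, 0 ≤ s → s < t →
    Q i t ω = Q i s ω - departures X Q i s t ω + (A i t ω - A i s ω)

end Queues

/-- Rate-stability, for arrival rates `l`, of the A-CSMA algorithm with functions `f`, `g`:
whatever the probability space, the arrival processes of rates `l`, the (schedule, channel) Markov
process and its initial law, the departure rates converge to `l` with probability one. -/
def ACSMARateStable (γ : ChannelState V H → ChannelState V H → ℝ)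
    (G : SimpleGraph V) [DecidableRel G.Adj] (f g : V → ℝ → ℝ) (l : V → ℝ) : Prop :=
  ∀ (Ω : Type w) [MeasurableSpace Ω] (P : Measure Ω) [IsProbabilityMeasure P]
    (X : ℝ → Ω → Schedule G × ChannelState V H) (A Q : V → ℝ → Ω → ℝ),
    IsMarkovJumpProcess P (acsmaRate γ G f g) X → IsArrivalProcess P l A →
    IsQueueProcess P X A Q →
    ∀ᵐ ω ∂P, ∀ i, Tendsto (fun t => (1 / t) * departures X Q i 0 t ω) atTop (𝓝 (l i))

/-- The functions define an EXP-A-CSMA algorithm with constants `r`: they are positive and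
`log (f i x / g i x) = r i * x` on `[0, 1]`. -/
def IsExpACSMA (r : V → ℝ) (f g : V → ℝ → ℝ) : Prop :=
  ∀ i, ∀ x ∈ Set.Icc (0 : ℝ) 1, 0 < f i x ∧ 0 < g i x ∧ Real.log (f i x / g i x) = r i * x

end Model

/-! ### Generators of finite chains: Poisson equation and reversibility. -/

section Generator

variable {S : Type*} [Fintype S] [DecidableEq S]

/-! Freeze the channel at `c`. With on-rates `K * exp (r i * c i)` and off-rates `K`, the schedule
dynamics is reversible with respect to an exponential family with parameter `r`. Averaging its mean
service over the stationary channel law gives the gradient of a convex log-partition function, so a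
rate vector with slack inside the capacity region is attained by some `r`: maximise the concave dual
function (`exists_parameter_of_mean`). The scale `K` does not affect the ratio of the rates, and a
large `K` makes the schedule equilibrate before the channel moves.

The stationary law of the joint chain is never computed. Instead, Poisson equations for the channel
and for each frozen schedule chain yield a corrector `φ i` for which service minus arrival rate is
at least the generator `L` applied to `φ i`, once the error of order `1/K` is absorbed by the slack
(`exists_service_domination`). Time averages of `L φ` along the path vanish almost surely, by
Dynkin's formula and a second-moment bound (`ae_tendsto_average_generator`). A pathwise argument
then shows that each queue is `o(t)` (`tendsto_departure_rate`), hence that departures have the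
arrival rate. -/

theorem generator_mulVec (q : S → S → ℝ) (φ : S → ℝ) (x : S) :
    (generator q).mulVec φ x = ∑ y, q x y * (φ y - φ x) := by
  rw [Matrix.mulVec, dotProduct, ← Finset.add_sum_erase _ _ (Finset.mem_univ x),
    ← Finset.add_sum_erase (f := fun y => q x y * (φ y - φ x)) _ (Finset.mem_univ x)]
  have h : ∀ y ∈ Finset.univ.erase x, generator q x y * φ y = q x y * φ y := by
    intro y hy
    have : x ≠ y := (Finset.ne_of_mem_erase hy).symm
    simp [generator, this]
  rw [Finset.sum_congr rfl h]
  simp only [generator, Matrix.of_apply, if_true, sub_self, mul_zero, zero_add, mul_sub,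
    Finset.sum_sub_distrib, ← Finset.sum_mul]
  ring

/-- Maximum principle: for an irreducible chain only the constants are harmonic. -/
theorem harmonic_eq_of_irreducible {q : S → S → ℝ} (hq : IsRates q) (hirr : IsIrreducibleRates q)
    {φ : S → ℝ} (hφ : (generator q).mulVec φ = 0) (x y : S) : φ x = φ y := by
  obtain ⟨m, -, hm⟩ := Finset.exists_max_image Finset.univ φ ⟨x, Finset.mem_univ x⟩
  have key : ∀ z, φ z = φ m := by
    intro z
    induction hirr m z with
    | refl => rfl
    | @tail b c _ hbc ih =>
      have h0 := congrFun hφ b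
      rw [generator_mulVec, Pi.zero_apply] at h0
      -- At a maximum point all summands of the harmonic equation have the same sign, so each
      -- vanishes and the maximum propagates along positive rates.
      have hle : ∀ y ∈ Finset.univ, q b y * (φ y - φ b) ≤ 0 := by
        intro y _
        by_cases hby : b = y
        · simp [hby]
        · exact mul_nonpos_of_nonneg_of_nonpos (hq b y hby)
            (by rw [ih]; linarith [hm y (Finset.mem_univ y)])
      have := (Finset.sum_eq_zero_iff_of_nonpos hle).1 h0 c (Finset.mem_univ c)
      rcases mul_eq_zero.1 this with h | h
      · exact absurd h hbc.2.ne'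
      · linarith
  rw [key x, key y]

/-- Solvability of the Poisson equation of an irreducible chain. -/
theorem exists_poisson_solution {q : S → S → ℝ} (hq : IsRates q) (hirr : IsIrreducibleRates q)
    {p : S → ℝ} (hp : IsStationaryLaw q p) {h : S → ℝ} (hh : ∑ x, p x * h x = 0) :
    ∃ φ : S → ℝ, ∀ x, ∑ y, q x y * (φ y - φ x) = h x := by
  obtain ⟨-, hp1, hbal⟩ := hp
  set T : (S → ℝ) →ₗ[ℝ] (S → ℝ) := (generator q).mulVecLin
  set ℓ : (S → ℝ) →ₗ[ℝ] ℝ := dotProductBilin ℝ ℝ p with hℓ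
  have hℓa : ∀ v, ℓ v = ∑ x, p x * v x := fun v => rfl
  have hle : LinearMap.range T ≤ LinearMap.ker ℓ := by
    rintro _ ⟨φ, rfl⟩
    rw [LinearMap.mem_ker, hℓa]
    simp only [T, Matrix.mulVecLin_apply, Matrix.mulVec, dotProduct, Finset.mul_sum]
    rw [Finset.sum_comm]
    refine Finset.sum_eq_zero fun y _ => ?_
    simp only [← mul_assoc, ← Finset.sum_mul, hbal y, zero_mul]
  have hker : LinearMap.ker T ≤ Submodule.span ℝ {fun _ => 1} := by
    intro φ hφ
    have hφ' : (generator q).mulVec φ = 0 := hφ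
    rw [Submodule.mem_span_singleton]
    rcases isEmpty_or_nonempty S with hS | ⟨⟨x⟩⟩
    · exact ⟨0, Subsingleton.elim _ _⟩
    · refine ⟨φ x, funext fun y => ?_⟩
      simp [harmonic_eq_of_irreducible hq hirr hφ' x y]
  have h1 : Module.finrank ℝ (LinearMap.ker T) ≤ 1 :=
    (Submodule.finrank_mono hker).trans ((finrank_span_le_card _).trans (by simp))
  have hsurj : LinearMap.range ℓ = ⊤ := by
    rw [LinearMap.range_eq_top]
    intro a
    refine ⟨fun _ => a, ?_⟩
    rw [hℓa, ← Finset.sum_mul, hp1, one_mul]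
  have h2 := LinearMap.finrank_range_add_finrank_ker T
  have h3 := LinearMap.finrank_range_add_finrank_ker ℓ
  rw [hsurj, finrank_top, Module.finrank_self] at h3
  -- The range of `T` has codimension at most one, since its kernel contains only constants; it lies
  -- in the hyperplane `ker ℓ`, hence equals it.
  have heq := Submodule.eq_of_le_of_finrank_le hle (by omega)
  have hmem : h ∈ LinearMap.range T := by rw [heq, LinearMap.mem_ker, hℓa, hh]
  obtain ⟨φ, rfl⟩ := hmem
  exact ⟨φ, fun x => (generator_mulVec q φ x).symm⟩

/-- Detailed balance with positive weights gives a stationary law. -/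
theorem isStationaryLaw_of_reversible {q : S → S → ℝ} {w : S → ℝ} (hw : ∀ x, 0 < w x)
    [Nonempty S] (hrev : ∀ x y, w x * q x y = w y * q y x) :
    IsStationaryLaw q fun x => w x / ∑ y, w y := by
  have hZ : 0 < ∑ y, w y := Finset.sum_pos (fun y _ => hw y) Finset.univ_nonempty
  refine ⟨fun x => (div_pos (hw x) hZ).le, by rw [← Finset.sum_div, div_self hZ.ne'], fun y => ?_⟩
  simp only [div_mul_eq_mul_div, ← Finset.sum_div]
  rw [← Finset.add_sum_erase _ _ (Finset.mem_univ y)]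
  have h : ∀ x ∈ Finset.univ.erase y, w x * generator q x y = w y * q y x := by
    intro x hx
    simp [generator, Finset.ne_of_mem_erase hx, hrev x y]
  rw [Finset.sum_congr rfl h, ← Finset.mul_sum, generator, Matrix.of_apply, if_pos rfl, mul_neg,
    neg_add_cancel, zero_div]

end Generator

/-! ### Exponential families and moment matching. -/

section ExponentialFamily

variable {C S V : Type*} [Fintype C] [Fintype S] [Fintype V]

/-- Partition function of the exponential family on `S` with features `a` and parameter `r`. -/
noncomputable def partitionFunction (a : S → V → ℝ) (r : V → ℝ) : ℝ :=
  ∑ s, Real.exp (∑ i, r i * a s i)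

theorem partitionFunction_pos [Nonempty S] (a : S → V → ℝ) (r : V → ℝ) :
    0 < partitionFunction a r :=
  Finset.sum_pos (fun _ _ => Real.exp_pos _) Finset.univ_nonempty

theorem le_log_partitionFunction [Nonempty S] (a : S → V → ℝ) (r : V → ℝ) (s : S) :
    ∑ i, r i * a s i ≤ Real.log (partitionFunction a r) := by
  rw [Real.le_log_iff_exp_le (partitionFunction_pos a r)]
  exact Finset.single_le_sum (f := fun s => Real.exp (∑ i, r i * a s i))
    (fun _ _ => (Real.exp_pos _).le) (Finset.mem_univ s)

theorem hasDerivAt_log_partitionFunction [DecidableEq V] [Nonempty S] (a : S → V → ℝ) (r : V → ℝ) (i : V) :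
    HasDerivAt (fun t : ℝ => Real.log (partitionFunction a (r + t • (Pi.single i 1 : V → ℝ))))
      ((∑ s, Real.exp (∑ j, r j * a s j) * a s i) / partitionFunction a r) 0 := by
  have hlin : ∀ s (t : ℝ), ∑ j, (r + t • (Pi.single i 1 : V → ℝ)) j * a s j
      = ∑ j, r j * a s j + t * a s i := by
    intro s t
    simp [add_mul, Finset.sum_add_distrib, Pi.single_apply]
  have hZ : HasDerivAt (fun t : ℝ => partitionFunction a (r + t • (Pi.single i 1 : V → ℝ)))
      (∑ s, Real.exp (∑ j, r j * a s j) * a s i) 0 := by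
    unfold partitionFunction
    simp only [hlin]
    refine HasDerivAt.fun_sum fun s _ => ?_
    have h : HasDerivAt (fun t : ℝ => ∑ j, r j * a s j + t * a s i) (a s i) 0 := by
      simpa using ((hasDerivAt_id (0 : ℝ)).mul_const (a s i)).const_add (∑ j, r j * a s j)
    simpa using h.exp
  have := hZ.log (by simpa using (partitionFunction_pos a r).ne')
  simpa using this

/-- A mean vector in the interior of the (downward closed) achievable region is the mean of a
mixture over `C` of exponential families with a common parameter. -/
theorem exists_parameter_of_mean [DecidableEq V] [Nonempty S] {p : C → ℝ} (hp : ∀ c, 0 ≤ p c)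
    (a : C → S → V → ℝ)
    (hdrop : ∀ c s (U : V → Prop) [DecidablePred U], ∃ s', ∀ i, a c s' i = if U i then a c s i else 0)
    {α : C → S → ℝ} (hα : ∀ c s, 0 ≤ α c s) (hα1 : ∀ c, ∑ s, α c s = 1)
    {m : V → ℝ} {δ : ℝ} (hδ : 0 < δ) (hm : ∀ i, δ ≤ m i)
    (hmx : ∀ i, m i + δ ≤ ∑ c, p c * ∑ s, α c s * a c s i) :
    ∃ r : V → ℝ, ∀ i, ∑ c, p c * ((∑ s, Real.exp (∑ j, r j * a c s j) * a c s i) /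
      partitionFunction (a c) r) = m i := by
  -- The critical points of `F` are exactly the parameters sought; a maximiser exists because `F`
  -- tends to `-∞` at infinity.
  set F : (V → ℝ) → ℝ := fun r =>
    ∑ i, r i * m i - ∑ c, p c * Real.log (partitionFunction (a c) r) with hF
  have hcont : Continuous F := by
    have : ∀ c, Continuous fun r => Real.log (partitionFunction (a c) r) := fun c =>
      Continuous.log (by unfold partitionFunction; fun_prop)
        fun r => (partitionFunction_pos (a c) r).ne'
    fun_prop
  -- Coordinates with `r i > 0` use the slack below the achievable mean, those with `r i < 0` use `δ
  -- ≤ m i`.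
  have hbound : ∀ r, F r ≤ -δ * ‖r‖ := by
    intro r
    have h1 : ∀ c, ∑ s, α c s * ∑ i, max (r i) 0 * a c s i ≤
        Real.log (partitionFunction (a c) r) := by
      intro c
      calc ∑ s, α c s * ∑ i, max (r i) 0 * a c s i
          ≤ ∑ s, α c s * Real.log (partitionFunction (a c) r) := by
            refine Finset.sum_le_sum fun s _ => mul_le_mul_of_nonneg_left ?_ (hα c s)
            -- Dropping the coordinates with `r i ≤ 0` replaces `r i` by its positive part in the
            -- exponent; this is where downward closure enters.
            obtain ⟨s', hs'⟩ := hdrop c s fun i => 0 < r i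
            refine le_trans (le_of_eq (Finset.sum_congr rfl fun i _ => ?_))
              (le_log_partitionFunction (a c) r s')
            rw [hs' i]
            split_ifs with h
            · rw [max_eq_left h.le]
            · rw [max_eq_right (not_lt.1 h), zero_mul, mul_zero]
        _ = _ := by rw [← Finset.sum_mul, hα1, one_mul]
    have h2 : ∑ i, max (r i) 0 * ∑ c, p c * ∑ s, α c s * a c s i ≤
        ∑ c, p c * Real.log (partitionFunction (a c) r) := by
      refine le_trans (le_of_eq ?_)
        (Finset.sum_le_sum fun c _ => mul_le_mul_of_nonneg_left (h1 c) (hp c))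
      simp only [Finset.mul_sum]
      rw [Finset.sum_comm]
      refine Finset.sum_congr rfl fun c _ => ?_
      rw [Finset.sum_comm]
      exact Finset.sum_congr rfl fun s _ => Finset.sum_congr rfl fun i _ => by ring
    have h3 : ‖r‖ ≤ ∑ i, |r i| :=
      (pi_norm_le_iff_of_nonneg (Finset.sum_nonneg fun i _ => abs_nonneg (r i))).2 fun i =>
        Finset.single_le_sum (f := fun i => |r i|) (fun i _ => abs_nonneg (r i)) (Finset.mem_univ i)
    have h4 : ∑ i, r i * m i ≤ ∑ i, max (r i) 0 * (∑ c, p c * ∑ s, α c s * a c s i) +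
        ∑ i, -δ * |r i| := by
      rw [← Finset.sum_add_distrib]
      refine Finset.sum_le_sum fun i _ => ?_
      rcases le_total 0 (r i) with h | h
      · rw [max_eq_left h, abs_of_nonneg h]
        nlinarith [mul_le_mul_of_nonneg_left (hmx i) h]
      · rw [max_eq_right h, abs_of_nonpos h]
        nlinarith [mul_le_mul_of_nonpos_left (hm i) h]
    rw [← Finset.mul_sum] at h4
    have h5 : -δ * ∑ i, |r i| ≤ -δ * ‖r‖ := mul_le_mul_of_nonpos_left h3 (by linarith)
    simp only [hF]
    linarith
  have hlim : Tendsto F (cocompact (V → ℝ)) atBot :=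
    tendsto_atBot_mono hbound
      ((tendsto_norm_cocompact_atTop (E := V → ℝ)).const_mul_atTop_of_neg (by linarith))
  obtain ⟨r, hr⟩ := hcont.exists_forall_ge hlim
  refine ⟨r, fun i => ?_⟩
  have hderiv : HasDerivAt (fun t : ℝ => F (r + t • (Pi.single i 1 : V → ℝ)))
      (m i - ∑ c, p c * ((∑ s, Real.exp (∑ j, r j * a c s j) * a c s i) /
        partitionFunction (a c) r)) 0 := by
    refine HasDerivAt.sub ?_
      (HasDerivAt.fun_sum fun c _ => (hasDerivAt_log_partitionFunction (a c) r i).const_mul (p c))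
    have hlin : ∀ t : ℝ, ∑ j, (r + t • (Pi.single i 1 : V → ℝ)) j * m j
        = ∑ j, r j * m j + t * m i := by
      intro t
      simp [add_mul, Finset.sum_add_distrib, Pi.single_apply]
    simp only [hlin]
    simpa using ((hasDerivAt_id (0 : ℝ)).mul_const (m i)).const_add (∑ j, r j * m j)
  have hmax : IsLocalMax (fun t : ℝ => F (r + t • (Pi.single i 1 : V → ℝ))) 0 :=
    Filter.Eventually.of_forall fun t => by simpa using hr (r + t • (Pi.single i 1 : V → ℝ))
  linarith [hmax.hasDerivAt_eq_zero hderiv]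

end ExponentialFamily

/-! ### Schedule dynamics in a frozen channel state. -/

section Glauber

variable {V : Type*} {H : Finset ℝ} {G : SimpleGraph V}

/-- The service vector of a schedule in a channel state. -/
def serviceVector (c : ChannelState V H) (σ : Schedule G) (i : V) : ℝ :=
  (c i : ℝ) * Schedule.bit σ i

theorem Schedule.bit_nonneg (σ : Schedule G) (i : V) : 0 ≤ Schedule.bit σ i := by
  unfold Schedule.bit; positivity

theorem Schedule.bit_le_one (σ : Schedule G) (i : V) : Schedule.bit σ i ≤ 1 := by
  unfold Schedule.bit
  exact_mod_cast Nat.lt_succ_iff.1 (σ.1 i).2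

/-- The restriction of a schedule to a set of links. -/
def Schedule.restrict (σ : Schedule G) (U : V → Prop) [DecidablePred U] : Schedule G :=
  ⟨fun i => if U i then σ.1 i else 0, fun i j hij => by
    have := σ.2 i j hij
    dsimp only
    split_ifs <;> simp <;> omega⟩

instance : Nonempty (Schedule G) := ⟨⟨fun _ => 0, fun _ _ _ => by simp⟩⟩

theorem exists_serviceVector_drop (c : ChannelState V H) (σ : Schedule G) (U : V → Prop)
    [DecidablePred U] :
    ∃ σ' : Schedule G, ∀ i, serviceVector c σ' i = if U i then serviceVector c σ i else 0 := by
  refine ⟨σ.restrict U, fun i => ?_⟩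
  by_cases h : U i <;> simp [serviceVector, Schedule.bit, Schedule.restrict, h]

variable [Fintype V]

/-- The Gibbs weight of a schedule in channel state `c`. -/
noncomputable def gibbsWeight (r : V → ℝ) (c : ChannelState V H) (σ : Schedule G) : ℝ :=
  Real.exp (∑ i, r i * serviceVector c σ i)

variable [DecidableEq V]

theorem gibbsWeight_of_update (r : V → ℝ) (c : ChannelState V H) {σ τ : Schedule G} {i : V}
    (hσ : σ.1 i = 0) (hτ : τ.1 = Function.update σ.1 i 1) :
    gibbsWeight r c σ * Real.exp (r i * c i) = gibbsWeight r c τ := by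
  rw [gibbsWeight, gibbsWeight, ← Real.exp_add]
  congr 1
  rw [← Finset.add_sum_erase _ _ (Finset.mem_univ i),
    ← Finset.add_sum_erase (f := fun i => r i * serviceVector c τ i) _ (Finset.mem_univ i)]
  have h : ∀ j ∈ Finset.univ.erase i, r j * serviceVector c σ j = r j * serviceVector c τ j := by
    intro j hj
    simp [serviceVector, Schedule.bit, hτ, Finset.ne_of_mem_erase hj]
  rw [Finset.sum_congr rfl h]
  simp [serviceVector, Schedule.bit, hτ, hσ]

variable [DecidableRel G.Adj]

/-- Rates of the schedule dynamics in a frozen channel state `c`, with on-rates `exp (r i * c i)`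
and unit off-rates. -/
noncomputable def glauberRate (r : V → ℝ) (c : ChannelState V H)
    (σ τ : Schedule G) : ℝ :=
  ∑ i, (if σ.1 i = 0 ∧ τ.1 = Function.update σ.1 i 1 then
      Real.exp (r i * c i) * ∏ j ∈ G.neighborFinset i, (1 - Schedule.bit σ j)
    else if σ.1 i = 1 ∧ τ.1 = Function.update σ.1 i 0 then 1 else 0)

theorem glauberRate_nonneg (r : V → ℝ) (c : ChannelState V H) (σ τ : Schedule G) :
    0 ≤ glauberRate r c σ τ := by
  refine Finset.sum_nonneg fun i _ => ?_
  split_ifs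
  · exact mul_nonneg (Real.exp_pos _).le
      (Finset.prod_nonneg fun j _ => sub_nonneg.2 (σ.bit_le_one j))
  · exact zero_le_one
  · exact le_rfl

/-- Feasibility of the target `τ` already forces the neighbours of `i` to be idle, so the blocking
factor never affects an actual transition. -/
theorem prod_one_sub_bit_of_update {σ τ : Schedule G} {i : V}
    (hτ : τ.1 = Function.update σ.1 i 1) :
    ∏ j ∈ G.neighborFinset i, (1 - Schedule.bit σ j) = 1 := by
  refine Finset.prod_eq_one fun j hj => ?_
  have hij : G.Adj i j := by simpa using hj
  have h := τ.2 i j hij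
  rw [hτ, Function.update_self, Function.update_of_ne hij.ne'] at h
  have : ((σ.1 j : Fin 2) : ℕ) = 0 := by simpa using h
  simp [Schedule.bit, this]

/-- Balance holds link by link: switching `i` on is the reverse of switching it off, and the ratio
`exp (r i * c i)` of the two rates is the ratio of the Gibbs weights. -/
theorem glauberRate_detailed_balance (r : V → ℝ) (c : ChannelState V H) (σ τ : Schedule G) :
    gibbsWeight r c σ * glauberRate r c σ τ = gibbsWeight r c τ * glauberRate r c τ σ := by
  unfold glauberRate
  rw [Finset.mul_sum, Finset.mul_sum]
  refine Finset.sum_congr rfl fun i _ => ?_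
  have hup : ∀ {σ τ : Schedule G}, σ.1 i = 0 ∧ τ.1 = Function.update σ.1 i 1 →
      τ.1 i = 1 ∧ σ.1 = Function.update τ.1 i 0 := by
    rintro σ τ ⟨h0, h1⟩
    refine ⟨by simp [h1], ?_⟩
    rw [h1, Function.update_idem, ← h0, Function.update_eq_self]
  have hdown : ∀ {σ τ : Schedule G}, σ.1 i = 1 ∧ τ.1 = Function.update σ.1 i 0 →
      τ.1 i = 0 ∧ σ.1 = Function.update τ.1 i 1 := by
    rintro σ τ ⟨h0, h1⟩
    refine ⟨by simp [h1], ?_⟩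
    rw [h1, Function.update_idem, ← h0, Function.update_eq_self]
  have key : ∀ {σ τ : Schedule G}, σ.1 i = 0 ∧ τ.1 = Function.update σ.1 i 1 →
      gibbsWeight r c σ * (Real.exp (r i * c i) *
        ∏ j ∈ G.neighborFinset i, (1 - Schedule.bit σ j)) = gibbsWeight r c τ := by
    rintro σ τ ⟨h0, h1⟩
    rw [prod_one_sub_bit_of_update h1, mul_one, gibbsWeight_of_update r c h0 h1]
  by_cases h1 : σ.1 i = 0 ∧ τ.1 = Function.update σ.1 i 1
  · have h2 := hup h1
    have h3 : ¬ (τ.1 i = 0 ∧ σ.1 = Function.update τ.1 i 1) := fun h => by simp [h2.1] at h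
    rw [if_pos h1, if_neg h3, if_pos h2, key h1, mul_one]
  · by_cases h2 : σ.1 i = 1 ∧ τ.1 = Function.update σ.1 i 0
    · have h3 := hdown h2
      rw [if_neg h1, if_pos h2, if_pos h3, key h3, mul_one]
    · rw [if_neg h1, if_neg h2, if_neg fun h => h2 (hup h), if_neg fun h => h1 (hdown h)]
      simp

theorem glauberRate_pos_of_update (r : V → ℝ) (c : ChannelState V H) {σ τ : Schedule G} {i : V}
    (hσ : σ.1 i = 1) (hτ : τ.1 = Function.update σ.1 i 0) : 0 < glauberRate r c σ τ := by
  refine Finset.sum_pos' (fun j _ => ?_) ⟨i, Finset.mem_univ i, ?_⟩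
  · split_ifs
    · exact mul_nonneg (Real.exp_pos _).le
        (Finset.prod_nonneg fun j _ => sub_nonneg.2 (σ.bit_le_one j))
    · exact zero_le_one
    · exact le_rfl
  · rw [if_neg (by simp [hσ]), if_pos ⟨hσ, hτ⟩]
    exact one_pos

/-- Switching links off one at a time keeps a schedule feasible and leads to the empty one; detailed
balance makes every such move reversible, so any two schedules communicate through the empty
schedule. -/
theorem glauberRate_irreducible (r : V → ℝ) (c : ChannelState V H) :
    IsIrreducibleRates (glauberRate (G := G) r c) := by
  have : Std.Symm fun σ τ : Schedule G => σ ≠ τ ∧ 0 < glauberRate r c σ τ := by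
    refine ⟨fun σ τ h => ⟨h.1.symm, ?_⟩⟩
    have h1 := mul_pos (Real.exp_pos (∑ i, r i * serviceVector c σ i)) h.2
    have h2 := glauberRate_detailed_balance r c σ τ
    rw [← gibbsWeight, h2] at h1
    exact (mul_pos_iff_of_pos_left (Real.exp_pos _)).1 h1
  have hzero : ∀ (n : ℕ) (σ : Schedule G), (Finset.univ.filter fun i => σ.1 i = 1).card = n →
      Relation.ReflTransGen (fun σ τ : Schedule G => σ ≠ τ ∧ 0 < glauberRate r c σ τ) σ
        (σ.restrict fun _ => False) := by
    intro n
    induction n with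
    | zero =>
      intro σ h
      rw [Finset.card_eq_zero, Finset.filter_eq_empty_iff] at h
      have : σ.restrict (fun _ => False) = σ := by
        refine Subtype.ext (funext fun i => ?_)
        have := h (Finset.mem_univ i)
        simp only [Schedule.restrict, if_false]
        omega
      rw [this]
    | succ n ih =>
      intro σ h
      obtain ⟨i, hi⟩ := Finset.card_pos.1 (by omega : 0 < (Finset.univ.filter fun i => σ.1 i = 1).card)
      have hi1 : σ.1 i = 1 := by simpa using hi
      have hτ : (σ.restrict fun j => j ≠ i).1 = Function.update σ.1 i 0 := by
        funext j
        by_cases hj : j = i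
        · subst hj; simp [Schedule.restrict]
        · simp [Schedule.restrict, hj]
      refine Relation.ReflTransGen.head ⟨fun he => ?_, glauberRate_pos_of_update r c hi1 hτ⟩
        (ih (σ.restrict fun j => j ≠ i) ?_)
      · have := congrArg (fun ρ : Schedule G => ρ.1 i) he
        simp [hτ, hi1] at this
      · have : (Finset.univ.filter fun j => (σ.restrict fun j => j ≠ i).1 j = 1) =
            (Finset.univ.filter fun i => σ.1 i = 1).erase i := by
          ext j
          by_cases hj : j = i
          · subst hj; simp [Schedule.restrict]
          · simp [Schedule.restrict, hj]
        rw [this, Finset.card_erase_of_mem hi, h]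
        rfl
  intro σ τ
  exact (hzero _ σ rfl).trans (Relation.ReflTransGen.stdSymm.symm _ _ (hzero _ τ rfl))

end Glauber

/-! ### Two-time laws and Dynkin's formula. -/

theorem abs_integral_mul_le_of_bounded {S Ω : Type*} [MeasurableSpace Ω] {P : Measure Ω}
    [IsProbabilityMeasure P] {X : ℝ → Ω → S} {a b : S → ℝ} {B : ℝ} (ha : ∀ x, |a x| ≤ B)
    (hb : ∀ x, |b x| ≤ B) (s u : ℝ) : |∫ ω, a (X s ω) * b (X u ω) ∂P| ≤ B * B := by
  have : Nonempty Ω := P.nonempty_of_neZero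
  have hB : 0 ≤ B := (abs_nonneg _).trans (ha (X 0 (Classical.arbitrary Ω)))
  have := norm_integral_le_of_norm_le_const (μ := P) (C := B * B)
    (f := fun ω => a (X s ω) * b (X u ω)) (Eventually.of_forall fun ω => by
      rw [Real.norm_eq_abs, abs_mul]
      exact mul_le_mul (ha _) (hb _) (abs_nonneg _) hB)
  simpa using this

section DynkinErgodic

variable {S : Type*} [Fintype S] [DecidableEq S]

-- Kolmogorov's equation in the form that Dynkin's formula needs, with the generator acting on `φ`.
open scoped Matrix.Norms.Operator in
theorem hasDerivAt_semigroup (L : Matrix S S ℝ) (φ : S → ℝ) (x : S) (s u : ℝ) :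
    HasDerivAt (fun u : ℝ => ∑ y, (NormedSpace.exp ((u - s) • L) : Matrix S S ℝ) x y * φ y)
      (∑ y, (NormedSpace.exp ((u - s) • L) : Matrix S S ℝ) x y * L.mulVec φ y) u := by
  have h1 : HasDerivAt (fun u : ℝ => (NormedSpace.exp ((u - s) • L) : Matrix S S ℝ))
      (NormedSpace.exp ((u - s) • L) * L) u := by
    exact (hasDerivAt_exp_smul_const (𝕂 := ℝ) L (u - s)).comp_sub_const u s
  let Λ : Matrix S S ℝ →ₗ[ℝ] ℝ :=
    { toFun := fun M => M.mulVec φ x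
      map_add' := fun M N => by simp [Matrix.add_mulVec]
      map_smul' := fun a M => by simp [Matrix.smul_mulVec] }
  have h2 := (LinearMap.toContinuousLinearMap Λ).hasFDerivAt.comp_hasDerivAt u h1
  have h3 : Λ (NormedSpace.exp ((u - s) • L) * L) =
      ∑ y, (NormedSpace.exp ((u - s) • L) : Matrix S S ℝ) x y * L.mulVec φ y := by
    change ((NormedSpace.exp ((u - s) • L) * L).mulVec φ) x = _
    rw [← Matrix.mulVec_mulVec]
    rfl
  rw [← h3]
  exact h2

variable {Ω : Type*} [MeasurableSpace Ω] {P : Measure Ω}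
  {q : S → S → ℝ} {X : ℝ → Ω → S}

theorem IsMarkovJumpProcess.measurable_comp (hX : IsMarkovJumpProcess P q X) (a : S → ℝ) {t : ℝ} (ht : 0 ≤ t) :
    Measurable fun ω => a (X t ω) := by
  let _ : MeasurableSpace S := ⊤
  exact (measurable_from_top (f := a)).comp (measurable_to_countable' fun x => hX.measurable t ht x)

variable [IsProbabilityMeasure P]

namespace IsMarkovJumpProcess

/-- The field `law` always prescribes the state at time `0`; summing over it recovers laws at later
times. -/
theorem real_inter_eq_sum (hX : IsMarkovJumpProcess P q X) {A : Set Ω} (hA : MeasurableSet A) :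
    P.real A = ∑ x, P.real {ω | X 0 ω = x ∧ ω ∈ A} := by
  have h : A = ⋃ x ∈ (Finset.univ : Finset S), {ω | X 0 ω = x ∧ ω ∈ A} := by
    ext ω; simp
  conv_lhs => rw [h]
  refine measureReal_biUnion_finset (fun x _ y _ hxy => ?_)
    fun x _ => (hX.measurable 0 le_rfl x).inter hA
  exact Set.disjoint_left.2 fun ω h1 h2 => hxy (h1.1.symm.trans h2.1)

theorem joint_law (hX : IsMarkovJumpProcess P q X) {s u : ℝ} (hs : 0 ≤ s) (hsu : s ≤ u) (x y : S) :
    P.real {ω | X s ω = x ∧ X u ω = y} =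
      P.real {ω | X s ω = x} * (NormedSpace.exp ((u - s) • generator q) : Matrix S S ℝ) x y := by
  let t : ℕ → ℝ := fun n => match n with | 0 => 0 | 1 => s | _ => u
  have ht : Monotone t := monotone_nat_of_le_succ fun n => by
    match n with
    | 0 => exact hs
    | 1 => exact hsu
    | n + 2 => exact le_rfl
  rw [hX.real_inter_eq_sum (A := {ω | X s ω = x ∧ X u ω = y})
      ((hX.measurable s hs x).inter (hX.measurable u (hs.trans hsu) y)),
    hX.real_inter_eq_sum (hX.measurable s hs x), Finset.sum_mul]
  refine Finset.sum_congr rfl fun z _ => ?_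
  let w : ℕ → S := fun n => match n with | 0 => z | 1 => x | _ => y
  have h1 := hX.law 1 t rfl ht w
  have h2 := hX.law 2 t rfl ht w
  have e1 : {ω | ∀ j ≤ 1, X (t j) ω = w j} = {ω | X 0 ω = z ∧ X s ω = x} := by
    ext ω
    refine ⟨fun h => ⟨h 0 (by norm_num), h 1 le_rfl⟩, fun h j hj => ?_⟩
    match j with
    | 0 => exact h.1
    | 1 => exact h.2
    | j + 2 => omega
  have e2 : {ω | ∀ j ≤ 2, X (t j) ω = w j} = {ω | X 0 ω = z ∧ X s ω = x ∧ X u ω = y} := by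
    ext ω
    refine ⟨fun h => ⟨h 0 (by norm_num), h 1 (by norm_num), h 2 le_rfl⟩, fun h j hj => ?_⟩
    match j with
    | 0 => exact h.1
    | 1 => exact h.2.1
    | 2 => exact h.2.2
    | j + 3 => omega
  rw [e1] at h1
  rw [e2, Finset.prod_range_succ, ← mul_assoc, ← h1] at h2
  exact h2

theorem integral_mul_eq (hX : IsMarkovJumpProcess P q X) (a b : S → ℝ) {s u : ℝ} (hs : 0 ≤ s)
    (hsu : s ≤ u) :
    ∫ ω, a (X s ω) * b (X u ω) ∂P = ∑ x, a x * P.real {ω | X s ω = x} *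
      ∑ y, (NormedSpace.exp ((u - s) • generator q) : Matrix S S ℝ) x y * b y := by
  have hmeas : ∀ x y, MeasurableSet {ω | X s ω = x ∧ X u ω = y} := fun x y =>
    (hX.measurable s hs x).inter (hX.measurable u (hs.trans hsu) y)
  have h : ∀ ω, a (X s ω) * b (X u ω) =
      ∑ x, ∑ y, Set.indicator {ω | X s ω = x ∧ X u ω = y} (fun _ => a x * b y) ω := by
    intro ω
    rw [Finset.sum_eq_single (X s ω), Finset.sum_eq_single (X u ω)]
    · simp
    · intro y _ hy
      simp [hy.symm]
    · simp
    · intro x _ hx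
      simp [hx.symm]
    · simp
  simp only [h]
  rw [integral_finsetSum _ fun x _ => integrable_finsetSum _ fun y _ =>
    (integrable_const _).indicator (hmeas x y)]
  refine Finset.sum_congr rfl fun x _ => ?_
  rw [integral_finsetSum _ fun y _ => (integrable_const _).indicator (hmeas x y), Finset.mul_sum]
  refine Finset.sum_congr rfl fun y _ => ?_
  rw [integral_indicator_const _ (hmeas x y), hX.joint_law hs hsu, smul_eq_mul]
  ring

/-- Dynkin's formula, in covariance form. -/
theorem integral_covariance_generator (hX : IsMarkovJumpProcess P q X) (a φ : S → ℝ) {s t : ℝ}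
    (hs : 0 ≤ s) (hst : s ≤ t) :
    ∫ u in s..t, ∫ ω, a (X s ω) * (generator q).mulVec φ (X u ω) ∂P =
      ∫ ω, a (X s ω) * φ (X t ω) ∂P - ∫ ω, a (X s ω) * φ (X s ω) ∂P := by
  rw [hX.integral_mul_eq a φ hs hst, hX.integral_mul_eq a φ hs le_rfl]
  have hder : ∀ u, HasDerivAt (fun u => ∑ x, a x * P.real {ω | X s ω = x} *
      ∑ y, (NormedSpace.exp ((u - s) • generator q) : Matrix S S ℝ) x y * φ y)
      (∑ x, a x * P.real {ω | X s ω = x} *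
        ∑ y, (NormedSpace.exp ((u - s) • generator q) : Matrix S S ℝ) x y *
          (generator q).mulVec φ y) u := fun u =>
    HasDerivAt.fun_sum fun x _ => (hasDerivAt_semigroup (generator q) φ x s u).const_mul _
  have hcont : Continuous fun u => ∑ x, a x * P.real {ω | X s ω = x} *
        ∑ y, (NormedSpace.exp ((u - s) • generator q) : Matrix S S ℝ) x y *
          (generator q).mulVec φ y :=
    continuous_finsetSum _ fun x _ => continuous_const.mul <| continuous_iff_continuousAt.2 fun u =>
      (hasDerivAt_semigroup (generator q) ((generator q).mulVec φ) x s u).continuousAt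
  rw [← intervalIntegral.integral_eq_sub_of_hasDerivAt (fun u _ => hder u)
    (hcont.intervalIntegrable _ _)]
  refine intervalIntegral.integral_congr fun u hu => ?_
  rw [Set.uIcc_of_le hst] at hu
  exact hX.integral_mul_eq a _ hs hu.1

end IsMarkovJumpProcess

end DynkinErgodic

/-! ### Measurability of right-continuous paths. -/

section RightContinuous

variable {S : Type*} {x : ℝ → S}

/-- The values of a right-continuous path into a discrete space are eventually read off on
the grids of mesh `1 / (n + 1)`. -/
theorem eventually_grid_eq_of_right_cts {t : ℝ} (ht : 0 ≤ t)
    (hx : ∀ᶠ s in 𝓝[>] t, x s = x t) :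
    ∀ᶠ n : ℕ in atTop, x ((⌊(n + 1 : ℝ) * t⌋₊ + 1 : ℝ) / (n + 1)) = x t := by
  -- The `+ 1` after the floor puts the grid point strictly to the right of `t`, where
  -- right-continuity applies.
  have hlt : ∀ n : ℕ, t < (⌊(n + 1 : ℝ) * t⌋₊ + 1 : ℝ) / (n + 1) := by
    intro n
    rw [lt_div_iff₀ (by positivity), mul_comm]
    exact Nat.lt_floor_add_one _
  have hle : ∀ n : ℕ, (⌊(n + 1 : ℝ) * t⌋₊ + 1 : ℝ) / (n + 1) ≤ t + 1 / ((n : ℝ) + 1) := by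
    intro n
    have h1 : ((n : ℝ) + 1) ≠ 0 := by positivity
    have h2 : (⌊(n + 1 : ℝ) * t⌋₊ : ℝ) ≤ (n + 1) * t := Nat.floor_le (by positivity)
    rw [div_le_iff₀ (by positivity), add_mul t, one_div, inv_mul_cancel₀ h1]
    linarith
  have hlim : Tendsto (fun n : ℕ => (⌊(n + 1 : ℝ) * t⌋₊ + 1 : ℝ) / (n + 1)) atTop (𝓝[>] t) := by
    refine tendsto_nhdsWithin_iff.2 ⟨?_, Eventually.of_forall hlt⟩
    refine tendsto_of_tendsto_of_tendsto_of_le_of_le tendsto_const_nhds ?_ (fun n => (hlt n).le) hle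
    simpa using tendsto_one_div_add_atTop_nhds_zero_nat.const_add t
  exact hlim.eventually hx

theorem aestronglyMeasurable_of_right_cts (a : S → ℝ)
    (hx : ∀ t, 0 ≤ t → ∀ᶠ s in 𝓝[>] t, x s = x t) :
    AEStronglyMeasurable (fun t => a (x t)) (volume.restrict (Set.Ici 0)) := by
  refine aestronglyMeasurable_of_tendsto_ae atTop
    (f := fun (n : ℕ) t => a (x ((⌊(n + 1 : ℝ) * t⌋₊ + 1 : ℝ) / (n + 1)))) (fun n => ?_) ?_
  · have h : Measurable fun k : ℕ => a (x ((k + 1 : ℝ) / (n + 1))) := measurable_from_top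
    exact (h.comp (Nat.measurable_floor.comp (measurable_const_mul _))).aestronglyMeasurable
  · filter_upwards [ae_restrict_mem measurableSet_Ici] with t ht
    exact tendsto_const_nhds.congr'
      ((eventually_grid_eq_of_right_cts ht (hx t ht)).mono fun n hn => congrArg a hn.symm)

theorem intervalIntegrable_of_right_cts [Finite S] (a : S → ℝ)
    (hx : ∀ t, 0 ≤ t → ∀ᶠ s in 𝓝[>] t, x s = x t) {u v : ℝ} (hu : 0 ≤ u) (hv : 0 ≤ v) :
    IntervalIntegrable (fun s => a (x s)) volume u v := by
  have := Fintype.ofFinite S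
  refine (intervalIntegrable_const (c := ∑ y, |a y|)).mono_fun ?_
    (Eventually.of_forall fun s => ?_)
  · exact (aestronglyMeasurable_of_right_cts a hx).mono_measure
      (Measure.restrict_mono (fun r hr => (le_min hu hv).trans hr.1.le) le_rfl)
  · exact (Finset.single_le_sum (f := fun y => |a y|) (fun _ _ => abs_nonneg _)
      (Finset.mem_univ (x s))).trans (le_abs_self _)

end RightContinuous

/-! ### Vanishing time averages of the generator. -/

section DynkinErgodic

variable {S : Type*} [Fintype S] [DecidableEq S]
  {Ω : Type*} [MeasurableSpace Ω] {P : Measure Ω}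
  {q : S → S → ℝ} {X : ℝ → Ω → S}

namespace IsMarkovJumpProcess

/-- Joint measurability, needed for Fubini: the grid approximations depend on time only through an
integer, and right-continuity gives their limit. -/
theorem aestronglyMeasurable_prod (hX : IsMarkovJumpProcess P q X) (a : S → ℝ) (t : ℝ) :
    AEStronglyMeasurable (fun z : Ω × ℝ => a (X z.2 z.1))
      (P.prod (volume.restrict (Set.Ioc 0 t))) := by
  refine aestronglyMeasurable_of_tendsto_ae atTop
    (f := fun (n : ℕ) z => a (X ((⌊(n + 1 : ℝ) * z.2⌋₊ + 1 : ℝ) / (n + 1)) z.1)) (fun n => ?_) ?_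
  · have hk : ∀ k : ℕ, 0 ≤ (k + 1 : ℝ) / (n + 1) := fun k => by positivity
    have h : Measurable fun z : Ω × ℕ => a (X ((z.2 + 1 : ℝ) / (n + 1)) z.1) :=
      measurable_from_prod_countable_left fun k => hX.measurable_comp a (hk k)
    exact (h.comp (measurable_fst.prodMk
      (Nat.measurable_floor.comp ((measurable_const_mul _).comp measurable_snd)))).aestronglyMeasurable
  · have h1 := (Measure.quasiMeasurePreserving_fst (μ := P)
      (ν := volume.restrict (Set.Ioc 0 t))).ae hX.right_cts
    have h2 := (Measure.quasiMeasurePreserving_snd (μ := P)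
      (ν := volume.restrict (Set.Ioc 0 t))).ae (ae_restrict_mem measurableSet_Ioc)
    filter_upwards [h1, h2] with z hz1 hz2
    exact tendsto_const_nhds.congr'
      ((eventually_grid_eq_of_right_cts (x := fun s => X s z.1) hz2.1.le
        (hz1 z.2 hz2.1.le)).mono fun n hn => congrArg a hn.symm)

variable [IsProbabilityMeasure P]

/-- The second moment of a path integral of `generator q *ᵥ φ` grows at most linearly. -/
theorem integral_sq_le (hX : IsMarkovJumpProcess P q X) (φ : S → ℝ) {B : ℝ}
    (hφ : ∀ x, |φ x| ≤ B) (hLφ : ∀ x, |(generator q).mulVec φ x| ≤ B) {t : ℝ} (ht : 0 ≤ t) :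
    Integrable (fun ω => (∫ s in (0)..t, (generator q).mulVec φ (X s ω)) ^ 2) P ∧
    ∫ ω, (∫ s in (0)..t, (generator q).mulVec φ (X s ω)) ^ 2 ∂P ≤ 4 * (B * B) * t := by
  set h := (generator q).mulVec φ with hh
  set ν := volume.restrict (Set.Ioc 0 t) with hν
  have hνfin : IsFiniteMeasure ν := by rw [hν]; infer_instance
  have hYm := hX.aestronglyMeasurable_prod h t
  have hfun : Integrable (fun z : Ω × ℝ × ℝ => h (X z.2.1 z.1) * h (X z.2.2 z.1))
      (P.prod (ν.prod ν)) := by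
    refine Integrable.of_bound (C := B * B) ?_ (Eventually.of_forall fun z => ?_)
    · have h1 : Measure.QuasiMeasurePreserving (fun z : Ω × ℝ × ℝ => (z.1, z.2.1))
          (P.prod (ν.prod ν)) (P.prod ν) := by
        refine ⟨by fun_prop, ?_⟩
        change Measure.map (Prod.map id Prod.fst) _ ≪ _
        rw [← Measure.map_prod_map _ _ measurable_id measurable_fst, Measure.map_id]
        exact Measure.AbsolutelyContinuous.rfl.prod
          Measure.quasiMeasurePreserving_fst.absolutelyContinuous
      have h2 : Measure.QuasiMeasurePreserving (fun z : Ω × ℝ × ℝ => (z.1, z.2.2))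
          (P.prod (ν.prod ν)) (P.prod ν) := by
        refine ⟨by fun_prop, ?_⟩
        change Measure.map (Prod.map id Prod.snd) _ ≪ _
        rw [← Measure.map_prod_map _ _ measurable_id measurable_snd, Measure.map_id]
        exact Measure.AbsolutelyContinuous.rfl.prod
          Measure.quasiMeasurePreserving_snd.absolutelyContinuous
      exact (hYm.comp_quasiMeasurePreserving h1).mul (hYm.comp_quasiMeasurePreserving h2)
    · rw [Real.norm_eq_abs, abs_mul]
      exact mul_le_mul (hLφ _) (hLφ _) (abs_nonneg _) ((abs_nonneg _).trans (hφ (X 0 z.1)))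
  have hsq : ∀ ω, (∫ s in (0)..t, h (X s ω)) ^ 2 =
      ∫ z, h (X z.1 ω) * h (X z.2 ω) ∂(ν.prod ν) := by
    intro ω
    rw [integral_prod_mul (fun s => h (X s ω)) (fun s => h (X s ω)),
      intervalIntegral.integral_of_le ht, sq]
  simp only [hsq]
  refine ⟨hfun.integral_prod_left, ?_⟩
  set K : ℝ × ℝ → ℝ := fun z => ∫ ω, h (X z.1 ω) * h (X z.2 ω) ∂P with hK
  have hKint : Integrable K (ν.prod ν) := hfun.integral_prod_right
  rw [integral_integral_swap (f := fun ω (z : ℝ × ℝ) => h (X z.1 ω) * h (X z.2 ω)) hfun]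
  change ∫ z, K z ∂(ν.prod ν) ≤ _
  have hmle : MeasurableSet {z : ℝ × ℝ | z.1 ≤ z.2} := measurableSet_le measurable_fst measurable_snd
  have hmlt : MeasurableSet {z : ℝ × ℝ | z.1 < z.2} := measurableSet_lt measurable_fst measurable_snd
  -- Dynkin's formula collapses the inner integral to two boundary terms, a bound uniform in `s` and
  -- `t`. Each triangle of the square thus contributes at most `2 * (B * B) * t`, the lower one by
  -- symmetry of `K`.
  have hmain : ∀ s ∈ Set.Ioc 0 t, ∫ u in s..t, K (s, u) ≤ 2 * (B * B) := by
    intro s hs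
    rw [hX.integral_covariance_generator h φ hs.1.le hs.2]
    have h1 := abs_le.1 (abs_integral_mul_le_of_bounded (P := P) (X := X) hLφ hφ s t)
    have h2 := abs_le.1 (abs_integral_mul_le_of_bounded (P := P) (X := X) hLφ hφ s s)
    linarith [h1.2, h2.1]
  have hint : ∀ A : Set (ℝ × ℝ), MeasurableSet A →
      (∀ s ∈ Set.Ioc 0 t, ∫ u, A.indicator K (s, u) ∂ν = ∫ u in s..t, K (s, u)) →
      ∫ z in A, K z ∂(ν.prod ν) ≤ 2 * (B * B) * t := by
    intro A hA hAK
    rw [← integral_indicator hA, integral_prod _ (hKint.indicator hA)]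
    calc ∫ s, ∫ u, A.indicator K (s, u) ∂ν ∂ν
        ≤ ∫ s, 2 * (B * B) ∂ν := by
          refine integral_mono_ae (hKint.indicator hA).integral_prod_left (integrable_const _) ?_
          filter_upwards [ae_restrict_mem measurableSet_Ioc] with s hs
          rw [hAK s hs]
          exact hmain s hs
      _ = 2 * (B * B) * t := by
          simp [hν, ht, mul_comm]
  have hle := hint _ hmle fun s hs => by
    rw [intervalIntegral.integral_of_le hs.2, ← integral_Icc_eq_integral_Ioc (x := s)]
    have : (fun u => Set.indicator {z : ℝ × ℝ | z.1 ≤ z.2} K (s, u)) =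
        Set.indicator (Set.Ici s) fun u => K (s, u) := by
      ext u; simp [Set.indicator]
    rw [this, integral_indicator measurableSet_Ici, hν, Measure.restrict_restrict measurableSet_Ici]
    congr 2
    ext u
    simp only [Set.mem_inter_iff, Set.mem_Ici, Set.mem_Ioc, Set.mem_Icc]
    exact ⟨fun h => ⟨h.1, h.2.2⟩, fun h => ⟨h.1, hs.1.trans_le h.1, h.2⟩⟩
  have hlt := hint _ hmlt fun s hs => by
    rw [intervalIntegral.integral_of_le hs.2]
    have : (fun u => Set.indicator {z : ℝ × ℝ | z.1 < z.2} K (s, u)) =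
        Set.indicator (Set.Ioi s) fun u => K (s, u) := by
      ext u; simp [Set.indicator]
    rw [this, integral_indicator measurableSet_Ioi, hν, Measure.restrict_restrict measurableSet_Ioi]
    congr 2
    ext u
    simp only [Set.mem_inter_iff, Set.mem_Ioi, Set.mem_Ioc]
    exact ⟨fun h => ⟨h.1, h.2.2⟩, fun h => ⟨h.1, hs.1.trans h.1, h.2⟩⟩
  have hswap : ∫ z in {z : ℝ × ℝ | z.1 ≤ z.2}ᶜ, K z ∂(ν.prod ν) =
      ∫ z in {z : ℝ × ℝ | z.1 < z.2}, K z ∂(ν.prod ν) := by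
    rw [← integral_indicator hmle.compl, ← integral_indicator hmlt, ← integral_prod_swap]
    refine integral_congr_ae (Eventually.of_forall fun z => ?_)
    simp only [Set.indicator, Set.mem_compl_iff, Set.mem_ofPred_eq, Prod.fst_swap, Prod.snd_swap,
      not_le, hK]
    simp only [mul_comm]
  rw [← integral_add_compl hmle hKint, hswap]
  linarith

/-- The time averages of `generator q *ᵥ φ` along the chain vanish almost surely. -/
theorem ae_tendsto_average_generator (hX : IsMarkovJumpProcess P q X) (φ : S → ℝ) :
    ∀ᵐ ω ∂P, Tendsto (fun t => (∫ s in (0)..t, (generator q).mulVec φ (X s ω)) / t) atTop (𝓝 0) := by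
  set h := (generator q).mulVec φ with hh
  set B := ∑ x, |φ x| + ∑ x, |h x| with hB
  have hφ : ∀ x, |φ x| ≤ B := fun x =>
    (Finset.single_le_sum (f := fun y => |φ y|) (fun _ _ => abs_nonneg _) (Finset.mem_univ x)).trans
      (le_add_of_nonneg_right (Finset.sum_nonneg fun _ _ => abs_nonneg _))
  have hhB : ∀ x, |h x| ≤ B := fun x =>
    (Finset.single_le_sum (f := fun y => |h y|) (fun _ _ => abs_nonneg _) (Finset.mem_univ x)).trans
      (le_add_of_nonneg_left (Finset.sum_nonneg fun _ _ => abs_nonneg _))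
  -- Along the times `(n + 1) ^ 2` the second moments of the averages are summable, so the averages
  -- converge almost surely there.
  set Z : ℕ → Ω → ℝ := fun n ω =>
    ((∫ s in (0)..((n : ℝ) + 1) ^ 2, h (X s ω)) / ((n : ℝ) + 1) ^ 2) ^ 2 with hZ
  have hsq : ∀ n : ℕ, Integrable (Z n) P ∧ ∫ ω, Z n ω ∂P ≤ 4 * (B * B) * (1 / ((n : ℝ) + 1) ^ 2) := by
    intro n
    obtain ⟨h1, h2⟩ := hX.integral_sq_le φ hφ hhB (t := ((n : ℝ) + 1) ^ 2) (by positivity)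
    simp only [hZ, div_pow]
    refine ⟨h1.div_const _, ?_⟩
    rw [integral_div, div_le_iff₀ (by positivity)]
    refine h2.trans (le_of_eq ?_)
    field_simp
  have hsumm : Summable fun n : ℕ => 4 * (B * B) * (1 / ((n : ℝ) + 1) ^ 2) := by
    refine Summable.mul_left _ ?_
    exact_mod_cast (summable_nat_add_iff 1).2 (Real.summable_one_div_nat_pow.2 one_lt_two)
  have hlint : ∑' n, ∫⁻ ω, ENNReal.ofReal (Z n ω) ∂P ≠ ⊤ := by
    refine ne_top_of_le_ne_top hsumm.tsum_ofReal_ne_top (ENNReal.tsum_le_tsum fun n => ?_)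
    rw [← ofReal_integral_eq_lintegral_ofReal (hsq n).1 (Eventually.of_forall fun ω => sq_nonneg _)]
    exact ENNReal.ofReal_le_ofReal (hsq n).2
  have hae : ∀ᵐ ω ∂P, Tendsto (fun n => Z n ω) atTop (𝓝 0) := by
    rw [← lintegral_tsum fun n => (hsq n).1.aestronglyMeasurable.aemeasurable.ennreal_ofReal] at hlint
    have := ae_lt_top' (AEMeasurable.tsum fun n =>
      (hsq n).1.aestronglyMeasurable.aemeasurable.ennreal_ofReal) hlint
    filter_upwards [this] with ω hω
    have h1 := ENNReal.tendsto_atTop_zero_of_tsum_ne_top hω.ne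
    have h2 := (ENNReal.tendsto_toReal ENNReal.zero_ne_top).comp h1
    refine h2.congr fun n => ?_
    exact ENNReal.toReal_ofReal (sq_nonneg _)
  filter_upwards [hae, hX.right_cts] with ω hω hrc
  have hω' : Tendsto (fun n : ℕ => |(∫ s in (0)..((n : ℝ) + 1) ^ 2, h (X s ω)) / ((n : ℝ) + 1) ^ 2|)
      atTop (𝓝 0) := by
    have := (Real.continuous_sqrt.tendsto 0).comp hω
    rw [Real.sqrt_zero] at this
    exact this.congr fun n => Real.sqrt_sq_eq_abs _
  have hB0 : 0 ≤ B := by positivity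
  -- The index `⌊√t⌋₊ - 1` selects the last square below `t`; the remaining gap is at most `3 * √t`,
  -- so it costs at most `3 * B / √t` in the average.
  have hfl : Tendsto (fun t : ℝ => ⌊√t⌋₊ - 1) atTop atTop :=
    (tendsto_sub_atTop_nat 1).comp (tendsto_nat_floor_atTop.comp Real.tendsto_sqrt_atTop)
  have hlim := (hω'.comp hfl).add ((Real.tendsto_sqrt_atTop.inv_tendsto_atTop).const_mul (3 * B))
  rw [mul_zero, add_zero] at hlim
  refine squeeze_zero_norm' ?_ hlim
  filter_upwards [eventually_ge_atTop (1 : ℝ)] with t ht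
  have hst : 1 ≤ √t := by rwa [Real.one_le_sqrt]
  have hn1 : 1 ≤ ⌊√t⌋₊ := (Nat.one_le_floor_iff _).2 hst
  have hcast : ((⌊√t⌋₊ - 1 : ℕ) : ℝ) + 1 = ⌊√t⌋₊ := by
    rw [Nat.cast_sub hn1]; simp
  simp only [Function.comp_apply, Pi.inv_apply, hcast]
  set n := ⌊√t⌋₊
  have hn : (n : ℝ) ≤ √t := Nat.floor_le (by positivity)
  have hn' : √t < n + 1 := Nat.lt_floor_add_one _
  have hn0 : (1 : ℝ) ≤ n := by exact_mod_cast hn1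
  have ht2 : √t ^ 2 = t := Real.sq_sqrt (by linarith)
  have hnt : (n : ℝ) ^ 2 ≤ t := by rw [← ht2]; gcongr
  have hsplit := intervalIntegral.integral_add_adjacent_intervals
    (intervalIntegrable_of_right_cts h hrc le_rfl (sq_nonneg (n : ℝ)))
    (intervalIntegrable_of_right_cts h hrc (sq_nonneg (n : ℝ)) (by linarith : 0 ≤ t))
  have hsmall : |∫ s in ((n : ℝ) ^ 2)..t, h (X s ω)| ≤ B * (t - (n : ℝ) ^ 2) := by
    have := intervalIntegral.norm_integral_le_of_norm_le_const (a := (n : ℝ) ^ 2) (b := t)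
      (f := fun s => h (X s ω)) (C := B) fun s _ => hhB _
    rwa [abs_of_nonneg (sub_nonneg.2 hnt), Real.norm_eq_abs] at this
  have hgap : t - (n : ℝ) ^ 2 ≤ 3 * √t := by nlinarith
  rw [← hsplit, Real.norm_eq_abs, add_div]
  refine (abs_add_le _ _).trans (add_le_add ?_ ?_)
  · rw [abs_div, abs_div, abs_of_pos (by positivity : (0 : ℝ) < (n : ℝ) ^ 2), abs_of_pos (by linarith : 0 < t)]
    gcongr
  · rw [abs_div, abs_of_pos (by linarith : 0 < t), div_le_iff₀ (by linarith)]
    calc _ ≤ B * (3 * √t) := hsmall.trans (by gcongr)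
      _ = 3 * B * (√t)⁻¹ * (√t ^ 2) := by field_simp
      _ = _ := by rw [ht2]

end IsMarkovJumpProcess

end DynkinErgodic

/-! ### Pathwise analysis of one queue. -/

section QueuePath

variable {σ Q A n : ℝ → ℝ} {l : ℝ}

/-- A work-conserving queue is bounded by the excess of arrivals over potential service since an
(almost) empty time. -/
theorem exists_empty_time_bound
    (hσ : ∀ u v, 0 ≤ u → 0 ≤ v → IntervalIntegrable σ volume u v)
    (hσQ : ∀ u v, 0 ≤ u → 0 ≤ v →
      IntervalIntegrable (fun r => σ r * (if 0 < Q r then 1 else 0)) volume u v)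
    (hσ0 : ∀ r, 0 ≤ r → 0 ≤ σ r) (hσ1 : ∀ r, 0 ≤ r → σ r ≤ 1)
    (hQ : ∀ t, 0 ≤ t → 0 ≤ Q t) (hQ0 : Q 0 = 0)
    (hdyn : ∀ s t, 0 ≤ s → s < t →
      Q t = Q s - (∫ r in s..t, σ r * (if 0 < Q r then 1 else 0)) + (A t - A s))
    {t : ℝ} (ht : 0 ≤ t) :
    ∃ r, 0 ≤ r ∧ r ≤ t ∧ Q t ≤ A t - A r - (∫ u in r..t, σ u) + 1 := by
  set Z : Set ℝ := {r | 0 ≤ r ∧ r ≤ t ∧ Q r = 0} with hZ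
  have hZne : Z.Nonempty := ⟨0, le_rfl, ht, hQ0⟩
  have hZb : BddAbove Z := ⟨t, fun r hr => hr.2.1⟩
  -- The last empty time need not be attained, as no continuity of `Q` is available. An empty time
  -- within `1` of the supremum suffices: the potential service in between is at most `1`, which is
  -- the additive constant.
  obtain ⟨r, hr, hrs⟩ := exists_lt_of_lt_csSup hZne (sub_one_lt (sSup Z))
  refine ⟨r, hr.1, hr.2.1, ?_⟩
  rcases hr.2.1.eq_or_lt with rfl | hrt
  · simp [hr.2.2]
  set s := sSup Z
  have hrs' : r ≤ s := le_csSup hZb hr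
  have hst : s ≤ t := csSup_le hZne fun r hr => hr.2.1
  have hs0 : 0 ≤ s := hr.1.trans hrs'
  rw [hdyn r t hr.1 hrt, hr.2.2,
    ← intervalIntegral.integral_add_adjacent_intervals (hσ r s hr.1 hs0) (hσ s t hs0 ht),
    ← intervalIntegral.integral_add_adjacent_intervals (hσQ r s hr.1 hs0) (hσQ s t hs0 ht)]
  have h1 : ∫ u in s..t, σ u * (if 0 < Q u then 1 else 0) = ∫ u in s..t, σ u := by
    rw [intervalIntegral.integral_of_le hst, intervalIntegral.integral_of_le hst]
    refine setIntegral_congr_fun measurableSet_Ioc fun u hu => ?_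
    have hu0 : 0 ≤ u := hs0.trans hu.1.le
    have : 0 < Q u := (hQ u hu0).lt_of_ne fun h =>
      absurd (le_csSup hZb ⟨hu0, hu.2, h.symm⟩) (not_le.2 hu.1)
    simp [this]
  have h2 : 0 ≤ ∫ u in r..s, σ u * (if 0 < Q u then 1 else 0) :=
    intervalIntegral.integral_nonneg hrs' fun u hu =>
      mul_nonneg (hσ0 u (hr.1.trans hu.1)) (by split_ifs <;> norm_num)
  have h3 : ∫ u in r..s, σ u ≤ s - r := by
    have := intervalIntegral.integral_mono_on hrs' (hσ r s hr.1 hs0)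
      (intervalIntegrable_const (c := (1 : ℝ))) fun u hu => hσ1 u (hr.1.trans hu.1)
    simpa using this
  rw [h1]
  linarith

/-- A queue whose service rate dominates its arrival rate, up to a perturbation with vanishing time
average, is rate-stable. -/
theorem tendsto_departure_rate
    (hσ : ∀ u v, 0 ≤ u → 0 ≤ v → IntervalIntegrable σ volume u v)
    (hσQ : ∀ u v, 0 ≤ u → 0 ≤ v →
      IntervalIntegrable (fun r => σ r * (if 0 < Q r then 1 else 0)) volume u v)
    (hσ0 : ∀ r, 0 ≤ r → 0 ≤ σ r) (hσ1 : ∀ r, 0 ≤ r → σ r ≤ 1)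
    (hQ : ∀ t, 0 ≤ t → 0 ≤ Q t) (hQ0 : Q 0 = 0)
    (hdyn : ∀ s t, 0 ≤ s → s < t →
      Q t = Q s - (∫ r in s..t, σ r * (if 0 < Q r then 1 else 0)) + (A t - A s))
    (hA0 : A 0 = 0) (hA : ∀ t, 0 ≤ t → 0 ≤ A t)
    (hAl : Tendsto (fun t => A t / t) atTop (𝓝 l))
    (hn : ∀ u v, 0 ≤ u → 0 ≤ v → IntervalIntegrable n volume u v)
    (hnσ : ∀ r, 0 ≤ r → l + n r ≤ σ r)
    (hN : Tendsto (fun t => (∫ r in (0)..t, n r) / t) atTop (𝓝 0)) :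
    Tendsto (fun t => (∫ r in (0)..t, σ r * (if 0 < Q r then 1 else 0)) / t) atTop (𝓝 l) := by
  -- `E` collects the fluctuations of arrivals and service; it is `o(t)` and its increments, plus
  -- `1`, bound the queue.
  set E : ℝ → ℝ := fun t => A t - l * t - ∫ r in (0)..t, n r with hE
  have hElim : Tendsto (fun t => E t / t) atTop (𝓝 0) := by
    have := (hAl.sub_const l).sub hN
    rw [sub_self, sub_zero] at this
    refine this.congr' ?_
    filter_upwards [eventually_gt_atTop (0 : ℝ)] with t ht
    simp only [hE]
    field_simp
  have hserv : ∀ r t, 0 ≤ r → r ≤ t →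
      l * (t - r) + ((∫ u in (0)..t, n u) - ∫ u in (0)..r, n u) ≤ ∫ u in r..t, σ u := by
    intro r t hr hrt
    have ht := hr.trans hrt
    rw [intervalIntegral.integral_interval_sub_left (hn 0 t le_rfl ht) (hn 0 r le_rfl hr)]
    have h1 := intervalIntegral.integral_mono_on hrt
      ((intervalIntegrable_const (c := l)).add (hn r t hr ht)) (hσ r t hr ht)
      fun u hu => hnσ u (hr.trans hu.1)
    rw [intervalIntegral.integral_add intervalIntegrable_const (hn r t hr ht)] at h1
    simp only [intervalIntegral.integral_const, smul_eq_mul] at h1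
    linarith
  -- This controls `E` at early times, where the limit of `E t / t` says nothing.
  have hElow : ∀ r, 0 ≤ r → -r ≤ E r := by
    intro r hr
    have h1 := hserv 0 r le_rfl hr
    have h2 := intervalIntegral.integral_mono_on hr (hσ 0 r le_rfl hr)
      (intervalIntegrable_const (c := (1 : ℝ))) fun u hu => hσ1 u hu.1
    simp only [intervalIntegral.integral_const, smul_eq_mul, intervalIntegral.integral_same] at h1 h2
    simp only [hE]
    linarith [hA r hr]
  have hQE : ∀ t, 0 ≤ t → ∃ r, 0 ≤ r ∧ r ≤ t ∧ Q t ≤ E t - E r + 1 := by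
    intro t ht
    obtain ⟨r, hr, hrt, h⟩ := exists_empty_time_bound hσ hσQ hσ0 hσ1 hQ hQ0 hdyn ht
    refine ⟨r, hr, hrt, ?_⟩
    simp only [hE]
    linarith [hserv r t hr hrt]
  have hQlim : Tendsto (fun t => Q t / t) atTop (𝓝 0) := by
    rw [Metric.tendsto_atTop]
    intro ε hε
    obtain ⟨T, hT⟩ := Metric.tendsto_atTop.1 hElim (ε / 4) (by linarith)
    have hbig : ∀ᶠ t : ℝ in atTop, max T 1 + 1 ≤ ε / 4 * t :=
      (tendsto_id.const_mul_atTop (by linarith : 0 < ε / 4)).eventually_ge_atTop _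
    obtain ⟨T', hT'⟩ := eventually_atTop.1 hbig
    refine ⟨max (max T 1) T', fun t ht => ?_⟩
    have htT : max T 1 ≤ t := (le_max_left _ _).trans ht
    have ht0 : 0 < t := lt_of_lt_of_le one_pos ((le_max_right _ _).trans htT)
    have hEb : ∀ u, max T 1 ≤ u → |E u| ≤ ε / 4 * u := by
      intro u hu
      have hu0 : 0 < u := lt_of_lt_of_le one_pos ((le_max_right _ _).trans hu)
      have := hT u ((le_max_left _ _).trans hu)
      rw [Real.dist_eq, sub_zero, abs_div, abs_of_pos hu0, div_lt_iff₀ hu0] at this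
      exact this.le
    obtain ⟨r, hr, hrt, hQr⟩ := hQE t ht0.le
    have h1 := abs_le.1 (hEb t htT)
    have h2 := hT' t ((le_max_right _ _).trans ht)
    rw [Real.dist_eq, sub_zero, abs_of_nonneg (div_nonneg (hQ t ht0.le) ht0.le), div_lt_iff₀ ht0]
    have hεt : 0 < ε * t := mul_pos hε ht0
    -- A late empty time makes both values of `E` small relative to `t`; for an early one `-E r` is
    -- at most `max T 1`, which `h2` absorbs.
    rcases le_total (max T 1) r with h | h
    · have h3 := abs_le.1 (hEb r h)
      have h4 : ε / 4 * r ≤ ε / 4 * t := by gcongr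
      linarith [le_max_right T 1]
    · linarith [hElow r hr]
  have := hAl.sub hQlim
  rw [sub_zero] at this
  refine this.congr' ?_
  filter_upwards [eventually_gt_atTop (0 : ℝ)] with t ht
  rw [← sub_div, hdyn 0 t le_rfl ht, hQ0, hA0]
  congr 1
  ring

end QueuePath

/-! ### Time-scale separation and rate-stability. -/

section RateStability

variable {V : Type*} [Fintype V] [DecidableEq V] {G : SimpleGraph V} [DecidableRel G.Adj]
  {H : Finset ℝ}

/-- The generator of A-CSMA with on-rates `K * exp (r i * x)` and off-rates `K` splits into the
channel dynamics and `K` times the schedule dynamics. -/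
theorem generator_acsmaRate_mulVec (γ : ChannelState V H → ChannelState V H → ℝ) (r : V → ℝ) (K : ℝ)
    (φ : Schedule G × ChannelState V H → ℝ) (σ : Schedule G) (c : ChannelState V H) :
    (generator (acsmaRate γ G (fun i x => K * Real.exp (r i * x)) fun _ _ => K)).mulVec φ (σ, c) =
      ∑ d, γ c d * (φ (σ, d) - φ (σ, c)) +
        K * ∑ τ, glauberRate r c σ τ * (φ (τ, c) - φ (σ, c)) := by
  -- The diagonal pair falls in both cases, harmlessly: all increments of `φ` vanish there.
  have h : ∀ τ d, acsmaRate γ G (fun i x => K * Real.exp (r i * x)) (fun _ _ => K) (σ, c) (τ, d) *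
      (φ (τ, d) - φ (σ, c)) =
      (if σ = τ then γ c d * (φ (σ, d) - φ (σ, c)) else 0) +
        (if c = d then K * (glauberRate r c σ τ * (φ (τ, c) - φ (σ, c))) else 0) := by
    intro τ d
    by_cases hσ : σ = τ
    · subst hσ
      by_cases hc : c = d
      · subst hc; simp
      · simp [acsmaRate, hc]
    · by_cases hc : c = d
      · subst hc
        rw [if_neg hσ, if_pos rfl, zero_add, ← mul_assoc]
        congr 1
        simp only [acsmaRate, if_neg hσ, if_true, glauberRate, Finset.mul_sum]
        refine Finset.sum_congr rfl fun i _ => ?_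
        split_ifs <;> ring
      · simp [acsmaRate, hσ, hc]
  rw [generator_mulVec, Fintype.sum_prod_type]
  simp only [h, Finset.sum_add_distrib]
  congr 1
  · rw [Finset.sum_comm]
    simp
  · simp [Finset.mul_sum]

/-- For a strictly admissible rate vector, suitable parameters make the potential service dominate
the arrival rates up to a term in the range of the generator. -/
theorem exists_service_domination {γ : ChannelState V H → ChannelState V H → ℝ}
    (hγ : IsRates γ) (hirr : IsIrreducibleRates γ) {l : V → ℝ} (hl : l ∈ strictlyAdmissible γ G) :
    ∃ (r : V → ℝ) (K : ℝ), 0 < K ∧ ∃ φ : V → Schedule G × ChannelState V H → ℝ, ∀ i x,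
      l i + (generator (acsmaRate γ G (fun i x => K * Real.exp (r i * x)) fun _ _ => K)).mulVec
        (φ i) x ≤ serviceVector x.2 x.1 i := by
  obtain ⟨hl0, x, ⟨p, hp, α, hα, hα1, hx⟩, hlx⟩ := hl
  -- One `δ` becomes excess service over `l` that absorbs the `1/K` error; the other keeps the mean
  -- `l + δ` inside the region, so that `r` exists.
  obtain ⟨δ, hδ, hδx⟩ : ∃ δ > 0, ∀ i, l i + δ + δ ≤ x i := by
    have : ∀ᶠ δ : ℝ in 𝓝[>] 0, ∀ i, l i + δ + δ < x i := by
      refine Filter.eventually_all.2 fun i => ?_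
      have hc : Tendsto (fun δ : ℝ => l i + δ + δ) (𝓝[>] 0) (𝓝 (l i + 0 + 0)) :=
        ((by fun_prop : Continuous fun δ : ℝ => l i + δ + δ).tendsto 0).mono_left
          nhdsWithin_le_nhds
      exact hc.eventually_lt_const (by simpa using hlx i)
    obtain ⟨δ, h1, h2⟩ := (this.and self_mem_nhdsWithin).exists
    exact ⟨δ, h2, fun i => (h1 i).le⟩
  obtain ⟨r, hr⟩ := exists_parameter_of_mean hp.1
    (fun (c : ChannelState V H) (s : Schedule G) => serviceVector c s)
    (fun c s U _ => exists_serviceVector_drop c s U) hα hα1 hδ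
    (m := fun i => l i + δ) (fun i => by linarith [hl0 i])
    (fun i => (hδx i).trans (le_of_eq (hx i)))
  set e : ChannelState V H → V → ℝ := fun c i =>
    (∑ s : Schedule G, Real.exp (∑ j, r j * serviceVector c s j) * serviceVector c s i) /
      partitionFunction (fun s : Schedule G => serviceVector c s) r with he
  have hχ : ∀ i, ∃ χ : ChannelState V H → ℝ, ∀ c, ∑ d, γ c d * (χ d - χ c) = e c i - (l i + δ) := by
    refine fun i => exists_poisson_solution hγ hirr hp ?_
    simp only [mul_sub, Finset.sum_sub_distrib, ← Finset.sum_mul, hp.2.1, one_mul]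
    exact sub_eq_zero.2 (hr i)
  have hψ : ∀ i c, ∃ ψ : Schedule G → ℝ, ∀ σ,
      ∑ τ, glauberRate r c σ τ * (ψ τ - ψ σ) = serviceVector c σ i - e c i := by
    intro i c
    have hstat := isStationaryLaw_of_reversible (q := glauberRate (G := G) r c)
      (w := gibbsWeight r c) (fun _ => Real.exp_pos _) (glauberRate_detailed_balance r c)
    refine exists_poisson_solution (fun σ τ _ => glauberRate_nonneg r c σ τ)
      (glauberRate_irreducible r c) hstat ?_
    simp only [mul_sub, Finset.sum_sub_distrib, ← Finset.sum_mul, hstat.2.1, one_mul]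
    rw [sub_eq_zero, he]
    simp only [div_mul_eq_mul_div, ← Finset.sum_div]
    rfl
  choose χ hχ using hχ
  choose ψ hψ using hψ
  -- Size of the channel generator on `ψ`. It does not involve `K`, so `K` may be chosen from it;
  -- the `1` added below keeps `K` positive.
  set M : V → Schedule G × ChannelState V H → ℝ := fun i x =>
    |∑ d, γ x.2 d * (ψ i d x.1 - ψ i x.2 x.1)| with hM
  have hM0 : ∀ i x, 0 ≤ M i x := fun i x => abs_nonneg _
  have hMsum : ∀ i x, M i x ≤ 1 + ∑ i, ∑ x, M i x := fun i x =>
    ((Finset.single_le_sum (f := fun x => M i x) (fun x _ => hM0 i x) (Finset.mem_univ x)).trans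
      (Finset.single_le_sum (f := fun i => ∑ x, M i x)
        (fun i _ => Finset.sum_nonneg fun x _ => hM0 i x) (Finset.mem_univ i))).trans (by linarith)
  have hK : 0 < (1 + ∑ i, ∑ x, M i x) / δ :=
    div_pos (add_pos_of_pos_of_nonneg one_pos
      (Finset.sum_nonneg fun i _ => Finset.sum_nonneg fun x _ => hM0 i x)) hδ
  set K := (1 + ∑ i, ∑ x, M i x) / δ with hKdef
  have hKδ : K * δ = 1 + ∑ i, ∑ x, M i x := div_mul_cancel₀ _ hδ.ne'
  -- The fast dynamics turns `ψ / K` into service minus its frozen mean `e`, the channel turns `χ`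
  -- into `e - (l + δ)`, and the only leftover is the channel acting on `ψ / K`, at most `δ`.
  refine ⟨r, K, hK, fun i x => ψ i x.2 x.1 / K + χ i x.2, fun i ⟨σ, c⟩ => ?_⟩
  rw [generator_acsmaRate_mulVec]
  have h1 : ∑ d, γ c d * (ψ i d σ / K + χ i d - (ψ i c σ / K + χ i c)) =
      (∑ d, γ c d * (ψ i d σ - ψ i c σ)) / K + (e c i - (l i + δ)) := by
    rw [← hχ i c, Finset.sum_div, ← Finset.sum_add_distrib]
    exact Finset.sum_congr rfl fun d _ => by ring
  have h2 : K * ∑ τ, glauberRate r c σ τ * (ψ i c τ / K + χ i c - (ψ i c σ / K + χ i c)) =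
      serviceVector c σ i - e c i := by
    rw [← hψ i c σ, Finset.mul_sum]
    refine Finset.sum_congr rfl fun τ _ => ?_
    field_simp
    ring
  have h3 : (∑ d, γ c d * (ψ i d σ - ψ i c σ)) / K ≤ δ := by
    rw [div_le_iff₀ hK, mul_comm, hKδ]
    exact (le_abs_self _).trans (hMsum i (σ, c))
  simp only [h1, h2]
  linarith

/-- Domination of the arrival rates by the potential service, up to a term in the range of the
generator, implies rate-stability. -/
theorem acsmaRateStable_of_service_domination (hH : IsCapacitySet H)
    {γ : ChannelState V H → ChannelState V H → ℝ} {f g : V → ℝ → ℝ} {l : V → ℝ}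
    (φ : V → Schedule G × ChannelState V H → ℝ)
    (hφ : ∀ i x, l i + (generator (acsmaRate γ G f g)).mulVec (φ i) x ≤ serviceVector x.2 x.1 i) :
    ACSMARateStable.{w} γ G f g l := by
  intro Ω _ P _ X A Q hX hA hQ
  have herg := ae_all_iff.2 fun i => hX.ae_tendsto_average_generator (φ i)
  filter_upwards [herg, hX.right_cts, hA.zero, hA.mono, hA.rate, hQ.path_measurable, hQ.nonneg,
    hQ.start, hQ.dynamics] with ω hN hrc hA0 hAm hAl hQm hQ0 hQs hQd i
  have hbit : ∀ x : Schedule G × ChannelState V H,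
      0 ≤ Schedule.bit x.1 i * (x.2 i : ℝ) ∧ Schedule.bit x.1 i * (x.2 i : ℝ) ≤ 1 := fun x => by
    have hc := hH.1 _ (x.2 i).2
    exact ⟨mul_nonneg (Schedule.bit_nonneg _ _) hc.1.le,
      mul_le_one₀ (Schedule.bit_le_one _ _) hc.1.le hc.2⟩
  have hσ : ∀ u v, 0 ≤ u → 0 ≤ v →
      IntervalIntegrable (fun t => serviceRate X i t ω) volume u v := fun u v hu hv =>
    intervalIntegrable_of_right_cts
      (fun x : Schedule G × ChannelState V H => Schedule.bit x.1 i * (x.2 i : ℝ)) hrc hu hv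
  have hbusy : AEStronglyMeasurable (fun t => if 0 < Q i t ω then (1 : ℝ) else 0)
      (volume.restrict (Set.Ici 0)) := by
    -- Queue paths are measurable only on non-negative times, so negative times are sent to `0`.
    have h1 : Measurable fun t : ℝ => if 0 < Q i (t.toNNReal : ℝ) ω then (1 : ℝ) else 0 :=
      Measurable.ite (measurableSet_lt measurable_const ((hQm i).comp measurable_real_toNNReal))
        measurable_const measurable_const
    refine h1.aestronglyMeasurable.congr ?_
    filter_upwards [ae_restrict_mem measurableSet_Ici] with t ht
    rw [Real.coe_toNNReal t ht]
  have hσQ : ∀ u v, 0 ≤ u → 0 ≤ v → IntervalIntegrable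
      (fun t => serviceRate X i t ω * (if 0 < Q i t ω then 1 else 0)) volume u v := by
    intro u v hu hv
    refine (hσ u v hu hv).mono_fun ?_ (Eventually.of_forall fun t => ?_)
    · exact (intervalIntegrable_iff.1 (hσ u v hu hv)).aestronglyMeasurable.mul (hbusy.mono_measure
        (Measure.restrict_mono (fun r hr => (le_min hu hv).trans hr.1.le) le_rfl))
    · simp only [norm_mul]
      exact mul_le_of_le_one_right (norm_nonneg _) (by split_ifs <;> simp)
  have := tendsto_departure_rate (σ := fun t => serviceRate X i t ω) (Q := fun t => Q i t ω)
    (A := fun t => A i t ω) (n := fun t => (generator (acsmaRate γ G f g)).mulVec (φ i) (X t ω))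
    hσ hσQ (fun t _ => (hbit (X t ω)).1) (fun t _ => (hbit (X t ω)).2) (hQ0 i) (hQs i)
    (fun s t hs hst => hQd i s t hs hst) (hA0 i)
    (fun t ht => (hA0 i).symm.le.trans (hAm i (Set.mem_Ici.2 le_rfl) ht ht)) (hAl i)
    (fun u v hu hv => intervalIntegrable_of_right_cts _ hrc hu hv)
    (fun t _ => (hφ i (X t ω)).trans (le_of_eq (mul_comm _ _))) (hN i)
  simp only [one_div_mul_eq_div]
  exact this

end RateStability

theorem isExpACSMA_const_mul_exp {V : Type*} (r : V → ℝ) {K : ℝ} (hK : 0 < K) :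
    IsExpACSMA r (fun i x => K * Real.exp (r i * x)) fun _ _ => K := by
  refine fun i x _ => ⟨by positivity, hK, ?_⟩
  rw [mul_div_cancel_left₀ _ hK.ne', Real.log_exp]

theorem theorem3p1 {V : Type*} [Fintype V] [DecidableEq V]
    (G : SimpleGraph V) [DecidableRel G.Adj]
    (H : Finset ℝ) (hH : IsCapacitySet H)
    (γ : ChannelState V H → ChannelState V H → ℝ)
    (hγ : IsRates γ) (hirr : IsIrreducibleRates γ)
    (l : V → ℝ) (hl : l ∈ strictlyAdmissible γ G) :
    ∃ (r : V → ℝ) (f g : V → ℝ → ℝ),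
      IsExpACSMA r f g ∧ ACSMARateStable.{w} γ G f g l := by
  obtain ⟨r, K, hK, φ, hφ⟩ := exists_service_domination hγ hirr hl
  exact ⟨r, _, _, isExpACSMA_const_mul_exp r hK, acsmaRateStable_of_service_domination hH φ hφ⟩
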